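/- Let $\binom{m}{r}$ denote the binomial coefficient for integers $m\ge 0$ and $r$, with $\binom{m}{r}=0$ if $r<0$ or $r>m$. For all integers $n\ge 1$ and $k\ge 0$, $$\det_{0\le i,j\le n-1}\left(\sum_{l=0}^{k}\binom{i+j}{\lfloor (i+j+1-k)/2\rfloor+l}\right)=\begin{cases}(-1)^{n_1\binom{k+1}{2}}&\text{if } n=(k+1)n_1 \text{ for an integer } n_1,\\(-1)^{n_1\binom{k+1}{2}}&\text{if } n=(k+1)n_1+1 \text{ for an integer } n_1,\\0&\text{if } n\not\equiv 0,1 \pmod{k+1}.\end{cases}$$ (For $k=0$ the first two cases both apply and both give $1$.) In particular, for $k=0$, $$\det_{0\le i,j\le n-1}\binom{i+j}{\lfloor (i+j+1)/2\rfloor}=\det_{0\le i,j\le n-1}\binom{i+j}{\lfloor (i+j)/2\rfloor}=1\qquad\text{for all } n\ge 1,$$ that is, all Hankel determinants of the sequence $\binom{m}{\lfloor m/2\rfloor}$, $m\ge 0$, equal $1$. -/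

import Mathlib

/-- The binomial coefficient `n.choose m` for a natural number `n` and an arbitrary integer `m`,
with the usual convention that it is `0` for `m < 0` (and for `m > n`). -/
def binomInt (n : ℕ) (m : ℤ) : ℤ :=
  if 0 ≤ m then (n.choose m.toNat : ℤ) else 0

/-- The entry `∑_{l=0}^k binom(m, ⌊(m+1-k)/2⌋ + l)`. Division of integers by `2` rounds down, so
`((m : ℤ) + 1 - k) / 2` is the floor of the rational number, also when `m + 1 - k` is negative. -/
def centralSum (k m : ℕ) : ℤ :=
  ∑ l ∈ Finset.range (k + 1), binomInt m (((m : ℤ) + 1 - (k : ℤ)) / 2 + (l : ℤ))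

/-- The `n × n` Hankel determinant `det_{0 ≤ i,j ≤ n-1} (a (i+j))`. -/
def hankelDet (n : ℕ) (a : ℕ → ℤ) : ℤ :=
  (Matrix.of fun i j : Fin n => a ((i : ℕ) + (j : ℕ))).det

/-!
Substituting `X = z + z⁻¹`, the Hankel determinants of `centralSum k` are Gram determinants of
`p ↦ L k p`, the constant term of `p (z + z⁻¹) (z ^ (-k) + ⋯ + z ^ (k + 1))`. Put `N = k + 1` and
let `C_N` be the rescaled Chebyshev polynomial with `C_N (z + z⁻¹) = z ^ N + z ^ (-N)`. The weight
equals `(1 + z ^ N) (1 + z + ⋯ + z ^ (N - 1)) z ^ (-k)`, so only exponents divisible by `N` matter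
and `L k (F (C_N) * q) = L 0 F * q 2` whenever `q` has degree at most `k`. Dividing by `C_N` then
gives `L k (F (C_N) * q) = -L k q * L 0 (F * (X - 2))` when `q` vanishes at `2` and has degree at
most `2 k + 1`.

The functionals `F ↦ L 0 F` and `F ↦ -L 0 (F * (X - 2))` have orthonormal polynomials `V_a` and
`S_a`, Chebyshev polynomials of the third and second kind. In the basis formed by `V_a (C_N)` and
`S_a (C_N) * (X - 2) ^ r`, `1 ≤ r ≤ k`, the Gram matrix is therefore block diagonal, each block
being the Hankel matrix of `μ r = L k ((X - 2) ^ r)`. As `μ` starts with `1, 0, …, 0, -1`, with `k`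
zeros, a full block has determinant `(-1) ^ (N.choose 2)`, and a truncated block of size between `2`
and `k` has a zero row.
-/

open Polynomial
open LaurentPolynomial (T T_add T_apply T_pow invert invert_apply single_eq_C_mul_T)
open scoped LaurentPolynomial

section Joukowski

variable (R : Type*) [CommRing R]

/-- The Laurent polynomial `z + z⁻¹`. Substituting it for the variable identifies `R[X]` with the
Laurent polynomials invariant under `z ↦ z⁻¹`. -/
noncomputable def joukowski : R[T;T⁻¹] := T 1 + T (-1)

/-- The substitution `z ↦ z ^ d` on Laurent polynomials. -/
noncomputable def laurentExpand (d : ℕ) : R[T;T⁻¹] →ₐ[R] R[T;T⁻¹] :=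
  AddMonoidAlgebra.mapDomainAlgHom R R (AddMonoidHom.mulLeft (d : ℤ))

variable {R}

lemma coeff_mul_T (f : R[T;T⁻¹]) (m n : ℤ) : (f * T n).coeff m = f.coeff (m - n) := by
  rw [T, AddMonoidAlgebra.coeff_mul_single_apply, mul_one, sub_eq_add_neg]

lemma laurentExpand_T (d : ℕ) (n : ℤ) : laurentExpand R d (T n) = T (d * n) := by
  simp [laurentExpand, T, -single_eq_C_mul_T]

lemma coeff_laurentExpand_mul_sum_T {d : ℕ} (hd : 0 < d) (g : R[T;T⁻¹]) (e : ℤ) :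
    (laurentExpand R d g * ∑ i ∈ Finset.range d, T (i : ℤ)).coeff e = g.coeff (e / d) := by
  induction g using LaurentPolynomial.induction_on' with
  | add p q hp hq =>
    simp only [map_add, add_mul, AddMonoidAlgebra.coeff_add, Finsupp.add_apply, hp, hq]
  | C_mul_T n a =>
    have hd' : (0 : ℤ) < d := Int.natCast_pos.2 hd
    have hnonneg := Int.emod_nonneg e hd'.ne'
    have hlt := Int.emod_lt_of_pos e hd'
    have hterm : ∀ i ∈ Finset.range d, (if d * n + i = e then 1 else 0 : R) =
        if i = (e % d).toNat then if n = e / d then 1 else 0 else 0 := by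
      intro i hi
      rw [← ite_and]
      have := Int.ediv_emod_unique (a := e) (r := i) (q := n) hd'
      exact if_congr (by have := Finset.mem_range.1 hi; lia) rfl rfl
    simp only [← LaurentPolynomial.smul_eq_C_mul, map_smul, laurentExpand_T, smul_mul_assoc,
      AddMonoidAlgebra.coeff_smul_apply, Finset.mul_sum, AddMonoidAlgebra.coeff_sum,
      Finsupp.finsetSum_apply, ← T_add, T_apply]
    rw [← Finset.smul_sum, Finset.sum_congr rfl hterm, Finset.sum_ite_eq',
      if_pos (Finset.mem_range.2 (by lia))]

lemma coeff_neg_aeval_joukowski (p : R[X]) (e : ℤ) :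
    (aeval (joukowski R) p).coeff (-e) = (aeval (joukowski R) p).coeff e := by
  have hinvert : invert (aeval (joukowski R) p) = aeval (joukowski R) p := by
    rw [← AlgEquiv.coe_toAlgHom, ← aeval_algHom_apply]
    simp [joukowski, add_comm]
  rw [← invert_apply, hinvert]

lemma joukowski_mul_T (n : ℤ) : joukowski R * T n = T (n + 1) + T (n - 1) := by
  rw [joukowski, add_mul, ← T_add, ← T_add, add_comm 1, neg_add_eq_sub]

lemma joukowski_pow (m : ℕ) :
    joukowski R ^ m = ∑ i ∈ Finset.range (m + 1), (m.choose i : R) • T (2 * i - m : ℤ) := by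
  rw [joukowski, add_pow]
  refine Finset.sum_congr rfl fun i hi ↦ ?_
  rw [T_pow, T_pow, ← T_add, mul_comm, Nat.cast_smul_eq_nsmul, nsmul_eq_mul,
    Nat.cast_sub (Finset.mem_range_succ_iff.1 hi)]
  ring_nf

lemma coeff_mul_joukowski_pow (f : R[T;T⁻¹]) (m : ℕ) (e : ℤ) :
    (f * joukowski R ^ m).coeff e =
      ∑ i ∈ Finset.range (m + 1), (m.choose i : R) * f.coeff (e + m - 2 * i) := by
  simp only [joukowski_pow, Finset.mul_sum, mul_smul_comm, AddMonoidAlgebra.coeff_sum,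
    Finsupp.finsetSum_apply, AddMonoidAlgebra.coeff_smul_apply, coeff_mul_T, smul_eq_mul,
    sub_sub_eq_add_sub]

lemma aeval_joukowski_mul_of_recurrence {P : ℕ → R[X]} {w : R[T;T⁻¹]} {c : ℤ} {ε : R}
    (zero : aeval (joukowski R) (P 0) * w = T c + ε • 1)
    (one : aeval (joukowski R) (P 1) * w = T (1 + c) + ε • T (-1))
    (add_two : ∀ n, P (n + 2) = X * P (n + 1) - P n) (n : ℕ) :
    aeval (joukowski R) (P n) * w = T (n + c) + ε • T (-n : ℤ) := by
  induction n using Nat.twoStepInduction with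
  | zero => simpa using zero
  | one => simpa using one
  | more n ih₀ ih₁ =>
    rw [add_two, map_sub, map_mul, aeval_X, sub_mul, mul_assoc, ih₀, ih₁, mul_add, mul_smul_comm,
      joukowski_mul_T, joukowski_mul_T]
    push_cast
    ring_nf
    simp only [smul_add]
    abel

lemma aeval_joukowski_chebyshevC (n : ℕ) :
    aeval (joukowski R) (Chebyshev.C R n) = T (n : ℤ) + T (-n : ℤ) := by
  have h := aeval_joukowski_mul_of_recurrence (P := fun n ↦ Chebyshev.C R n) (w := 1) (c := 0)
    (ε := 1) (by simp [one_add_one_eq_two, map_ofNat]) (by simp [joukowski])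
    (fun n ↦ mod_cast Chebyshev.C_add_two R n) n
  simpa using h

lemma aeval_joukowski_comp_chebyshevC (p : R[X]) (d : ℕ) :
    aeval (joukowski R) (p.comp (Chebyshev.C R d)) =
      laurentExpand R d (aeval (joukowski R) p) := by
  rw [aeval_comp, aeval_joukowski_chebyshevC, ← aeval_algHom_apply, joukowski, map_add,
    laurentExpand_T, laurentExpand_T, mul_one, mul_neg_one]

lemma coeff_zero_aeval_joukowski_mul {p q : R[X]} {c : ℤ} {ε : R} {a b : ℕ} (hc : a + b + c ≠ 0)
    (hp : aeval (joukowski R) p * (T c + ε • 1) = T (a + c) + ε • T (-a : ℤ))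
    (hq : aeval (joukowski R) q * (T c + ε • 1) = T (b + c) + ε • T (-b : ℤ)) :
    (aeval (joukowski R) (p * q) * (T c + ε • 1)).coeff 0 = if a = b then ε else 0 := by
  have hsymm : (aeval (joukowski R) p * T (-b : ℤ)).coeff 0 =
      (aeval (joukowski R) p * T (b : ℤ)).coeff 0 := by
    simp only [coeff_mul_T, zero_sub, coeff_neg_aeval_joukowski]
  calc
    _ = (aeval (joukowski R) p * (T (b + c) + ε • T (-b : ℤ))).coeff 0 := by
      rw [map_mul, mul_assoc, hq]
    _ = (aeval (joukowski R) p * (T (b + c) + ε • T (b : ℤ))).coeff 0 := by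
      simp only [mul_add, mul_smul_comm, AddMonoidAlgebra.coeff_add, AddMonoidAlgebra.coeff_smul,
        Finsupp.add_apply, Finsupp.smul_apply, hsymm]
    _ = ((T (a + c) + ε • T (-a : ℤ)) * T (b : ℤ)).coeff 0 := by
      rw [← hp, mul_assoc, add_mul, smul_mul_assoc, one_mul, ← T_add, add_comm c]
    _ = if a = b then ε else 0 := by
      have hac : (a + c : ℤ) ≠ -b := by lia
      simp [coeff_mul_T, T_apply, hac]

lemma coeff_joukowski_pow (m : ℕ) (j : ℤ) :
    (joukowski R ^ m).coeff (2 * j - m) = binomInt m j := by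
  simp only [joukowski_pow, AddMonoidAlgebra.coeff_sum, Finsupp.finsetSum_apply,
    AddMonoidAlgebra.coeff_smul_apply, T_apply, smul_eq_mul, mul_ite, mul_one, mul_zero, binomInt]
  rcases le_or_gt 0 j with hj | hj
  · lift j to ℕ using hj
    have hchoose : m < j → 0 = (m.choose j : R) := fun h ↦ by
      rw [Nat.choose_eq_zero_of_lt h, Nat.cast_zero]
    simpa using hchoose
  · rw [if_neg hj.not_ge, Finset.sum_eq_zero fun i _ ↦ if_neg (by lia), Int.cast_zero]

lemma coeff_joukowski_pow_of_odd {m : ℕ} {e : ℤ} (h : Odd (m + e)) :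
    (joukowski R ^ m).coeff e = 0 := by
  simp only [joukowski_pow, AddMonoidAlgebra.coeff_sum, Finsupp.finsetSum_apply,
    AddMonoidAlgebra.coeff_smul_apply, T_apply, smul_eq_mul, mul_ite, mul_one, mul_zero]
  exact Finset.sum_eq_zero fun i _ ↦ if_neg (by grind)

lemma coeff_joukowski_pow_add_coeff_succ (m : ℕ) (e : ℤ) :
    (joukowski R ^ m).coeff e + (joukowski R ^ m).coeff (e + 1) = binomInt m ((m + e + 1) / 2) := by
  rcases Int.even_or_odd' (m + e) with ⟨j, hj | hj⟩
  · rw [coeff_joukowski_pow_of_odd (e := e + 1) ⟨j, by lia⟩, add_zero,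
      show e = 2 * j - m by lia, coeff_joukowski_pow]
    congr; lia
  · rw [coeff_joukowski_pow_of_odd (e := e) ⟨j, hj⟩, zero_add,
      show e + 1 = 2 * (j + 1) - m by lia, coeff_joukowski_pow]
    congr; lia

end Joukowski

section CentralFunctional

variable (R : Type*) [CommRing R]

/-- The Laurent polynomial `z ^ (-k) + z ^ (-k + 1) + ⋯ + z ^ (k + 1)`, the weight against which
powers of `z + z⁻¹` have constant terms `centralSum k`. -/
noncomputable def centralWeight (k : ℕ) : R[T;T⁻¹] :=
  ∑ i ∈ Finset.range (2 * (k + 1)), T (i - k : ℤ)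

/-- The linear functional on `R[X]` with moments `centralSum k`: the constant term of
`p (z + z⁻¹)` times `centralWeight R k`. -/
noncomputable def centralFunctional (k : ℕ) : R[X] →ₗ[R] R :=
  Finsupp.lapply 0 ∘ₗ (AddMonoidAlgebra.coeffLinearEquiv R).toLinearMap ∘ₗ
    LinearMap.mulRight R (centralWeight R k) ∘ₗ (aeval (joukowski R)).toLinearMap

lemma centralWeight_zero : centralWeight R 0 = T 1 + 1 := by
  simp [centralWeight, Finset.sum_range_succ, add_comm]

lemma centralWeight_eq_laurentExpand_mul (k : ℕ) :
    centralWeight R k =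
      laurentExpand R (k + 1) (T 1 + 1) * (∑ i ∈ Finset.range (k + 1), T (i : ℤ)) * T (-k : ℤ) := by
  have hshift (i : ℕ) : T (i - k : ℤ) = (T (i : ℤ) * T (-k : ℤ) : R[T;T⁻¹]) := by
    rw [← T_add, sub_eq_add_neg]
  simp only [centralWeight, hshift, ← Finset.sum_mul]
  rw [two_mul, Finset.sum_range_add, map_add, map_one, laurentExpand_T]
  simp only [Nat.cast_add, T_add, ← Finset.mul_sum, mul_one]
  ring

variable {R}

lemma centralFunctional_apply (k : ℕ) (p : R[X]) :
    centralFunctional R k p = (aeval (joukowski R) p * centralWeight R k).coeff 0 :=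
  rfl

lemma centralFunctional_zero_apply (p : R[X]) :
    centralFunctional R 0 p = (aeval (joukowski R) p * (T 1 + 1)).coeff 0 := by
  rw [centralFunctional_apply, centralWeight_zero]

lemma centralFunctional_zero_mul_X_sub_two (p : R[X]) :
    centralFunctional R 0 (p * (X - 2)) = (aeval (joukowski R) p * (T 2 - 1)).coeff 0 := by
  have hsymm := coeff_neg_aeval_joukowski p 1
  have hweight : aeval (joukowski R) (X - 2 : R[X]) * (T 1 + 1) = T 2 + T (-1) - T 1 - 1 := by
    rw [map_sub, aeval_X, map_ofNat, sub_mul, mul_add, joukowski_mul_T, mul_one, joukowski,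
      one_add_one_eq_two, sub_self, LaurentPolynomial.T_zero]
    ring
  rw [centralFunctional_zero_apply, map_mul, mul_assoc, hweight]
  simp [mul_add, mul_sub, coeff_mul_T, hsymm]

lemma centralFunctional_X_pow (k m : ℕ) : centralFunctional R k (X ^ m) = centralSum k m := by
  have hpair (g : ℤ → R) (n : ℕ) : ∑ i ∈ Finset.range (2 * n), g i =
      ∑ l ∈ Finset.range n, (g (2 * l : ℕ) + g (2 * l + 1 : ℕ)) := by
    induction n with
    | zero => simp
    | succ n ih => rw [mul_add_one, Finset.sum_range_succ, Finset.sum_range_succ, ih,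
        Finset.sum_range_succ, add_assoc]
  have hcoeff (i : ℤ) :
      (joukowski R ^ m * T (i - k)).coeff 0 = (joukowski R ^ m).coeff (i - k) := by
    rw [coeff_mul_T, zero_sub, ← aeval_X (R := R) (joukowski R), ← map_pow,
      coeff_neg_aeval_joukowski]
  simp only [centralFunctional_apply, map_pow, aeval_X, centralWeight, Finset.mul_sum,
    AddMonoidAlgebra.coeff_sum, Finsupp.finsetSum_apply, hcoeff]
  rw [hpair fun i ↦ (joukowski R ^ m).coeff (i - k), centralSum, Int.cast_sum]
  refine Finset.sum_congr rfl fun l _ ↦ ?_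
  have := coeff_joukowski_pow_add_coeff_succ (R := R) m (2 * l - k)
  push_cast
  rw [add_sub_right_comm, this]
  congr
  lia

lemma centralFunctional_comp_mul_X_pow {k m : ℕ} (hm : m ≤ k) (F : R[X]) :
    centralFunctional R k (F.comp (Chebyshev.C R (k + 1 : ℕ)) * X ^ m) =
      centralFunctional R 0 F * 2 ^ m := by
  set g := aeval (joukowski R) F * (T 1 + 1) with hg
  have hg₀ : g.coeff 0 = centralFunctional R 0 F := (centralFunctional_zero_apply F).symm
  have hg₁ : g.coeff 1 = g.coeff 0 := by
    have := coeff_neg_aeval_joukowski F 1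
    simp [hg, mul_add, coeff_mul_T, this, add_comm]
  have hcoeff : ∀ i ∈ Finset.range (m + 1), g.coeff ((k + m - 2 * i : ℤ) / (k + 1 : ℕ)) =
      centralFunctional R 0 F := by
    intro i hi
    have hi' := Finset.mem_range_succ_iff.1 hi
    have hnonneg : 0 ≤ (k + m - 2 * i : ℤ) / (k + 1 : ℕ) := Int.ediv_nonneg (by lia) (by lia)
    have hlt : (k + m - 2 * i : ℤ) / (k + 1 : ℕ) < 2 := Int.ediv_lt_of_lt_mul (by lia) (by lia)
    generalize (k + m - 2 * i : ℤ) / (k + 1 : ℕ) = e at hnonneg hlt ⊢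
    obtain rfl | rfl : e = 0 ∨ e = 1 := by lia
    · exact hg₀
    · exact hg₁.trans hg₀
  have hfactor : aeval (joukowski R) (F.comp (Chebyshev.C R (k + 1 : ℕ)) * X ^ m) *
      centralWeight R k = laurentExpand R (k + 1) g * (∑ i ∈ Finset.range (k + 1), T (i : ℤ)) *
        joukowski R ^ m * T (-k : ℤ) := by
    rw [map_mul, map_pow, aeval_X, aeval_joukowski_comp_chebyshevC, hg, map_mul,
      centralWeight_eq_laurentExpand_mul]
    ring
  rw [centralFunctional_apply, hfactor, coeff_mul_T, zero_sub, neg_neg, coeff_mul_joukowski_pow]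
  simp only [coeff_laurentExpand_mul_sum_T k.succ_pos]
  rw [Finset.sum_congr rfl fun i hi ↦ congrArg _ (hcoeff i hi), ← Finset.sum_mul,
    ← Nat.cast_sum, Nat.sum_range_choose, Nat.cast_pow, Nat.cast_two, mul_comm]

lemma centralFunctional_comp_mul {k : ℕ} (F : R[X]) {q : R[X]} (hq : q.natDegree ≤ k) :
    centralFunctional R k (F.comp (Chebyshev.C R (k + 1 : ℕ)) * q) =
      centralFunctional R 0 F * q.eval 2 := by
  rw [eval_eq_sum_range' (Nat.lt_succ_of_le hq), Finset.mul_sum]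
  conv_lhs => rw [q.as_sum_range' (k + 1) (Nat.lt_succ_of_le hq), Finset.mul_sum, map_sum]
  refine Finset.sum_congr rfl fun m hm ↦ ?_
  rw [← smul_X_eq_monomial, mul_smul_comm, map_smul,
    centralFunctional_comp_mul_X_pow (Finset.mem_range_succ_iff.1 hm), smul_eq_mul]
  ring

lemma isMonicOfDegree_of_recurrence [Nontrivial R] {P : ℕ → R[X]} {d : ℕ}
    (zero : IsMonicOfDegree (P 0) d) (one : IsMonicOfDegree (P 1) (d + 1))
    (add_two : ∀ n, P (n + 2) = X * P (n + 1) - P n) (n : ℕ) : IsMonicOfDegree (P n) (d + n) := by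
  induction n using Nat.twoStepInduction with
  | zero => exact zero
  | one => exact one
  | more n ih₀ ih₁ =>
    rw [add_two]
    refine IsMonicOfDegree.sub ?_ (ih₀.natDegree_eq.trans_lt (by lia))
    rw [show d + (n + 2) = 1 + (d + (n + 1)) by ring]
    exact (isMonicOfDegree_X R).mul ih₁

lemma isMonicOfDegree_X_sub_two [Nontrivial R] : IsMonicOfDegree (X - 2 : R[X]) 1 :=
  isMonicOfDegree_X_sub_one 2

lemma isMonicOfDegree_chebyshevC_succ [Nontrivial R] (k : ℕ) :
    IsMonicOfDegree (Chebyshev.C R (k + 1 : ℕ)) (k + 1) := by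
  rw [add_comm k 1]
  refine isMonicOfDegree_of_recurrence (P := fun n ↦ Chebyshev.C R (1 + n : ℕ)) ?_ ?_ ?_ k
  · simpa using isMonicOfDegree_X R
  · simpa [Chebyshev.C_two] using (isMonicOfDegree_X_pow R 2).sub (q := 2) (by simp)
  · exact fun n ↦ mod_cast Chebyshev.C_add_two R (1 + n : ℕ)

lemma isMonicOfDegree_chebyshevS [Nontrivial R] (n : ℕ) :
    IsMonicOfDegree (Chebyshev.S R n) n := by
  suffices IsMonicOfDegree (Chebyshev.S R n) (0 + n) by rwa [zero_add] at this
  refine isMonicOfDegree_of_recurrence (P := fun n ↦ Chebyshev.S R n) ?_ ?_ ?_ n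
  · simp
  · simpa using isMonicOfDegree_X R
  · exact fun n ↦ mod_cast Chebyshev.S_add_two R n

lemma centralFunctional_zero_one : centralFunctional R 0 1 = 1 := by
  simp [centralFunctional_zero_apply, T_apply]

lemma centralFunctional_zero_X_sub_two : centralFunctional R 0 (X - 2) = -1 := by
  rw [← one_mul (X - 2), centralFunctional_zero_mul_X_sub_two]
  simp [T_apply]

lemma centralFunctional_comp_mul_of_eval_two {k : ℕ} {F q : R[X]} (hq : q.natDegree ≤ 2 * k + 1)
    (hroot : q.eval 2 = 0) :
    centralFunctional R k (F.comp (Chebyshev.C R (k + 1 : ℕ)) * q) =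
      (q /ₘ Chebyshev.C R (k + 1 : ℕ)).eval 2 * centralFunctional R 0 (F * (X - 2)) := by
  nontriviality R
  set c := Chebyshev.C R (k + 1 : ℕ) with hc
  have hmonic : IsMonicOfDegree c (k + 1) := isMonicOfDegree_chebyshevC_succ k
  have hdiv := modByMonic_add_div q c
  have hrem : (q %ₘ c).natDegree ≤ k := by
    have := natDegree_modByMonic_lt q hmonic.monic fun h ↦ by
      simpa [h] using hmonic.natDegree_eq
    rw [hmonic.natDegree_eq] at this
    lia
  have hquot : (q /ₘ c).natDegree ≤ k := by
    rw [natDegree_divByMonic q hmonic.monic, hmonic.natDegree_eq]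
    lia
  have heval : (q %ₘ c).eval 2 = -(2 * (q /ₘ c).eval 2) := by
    have := congrArg (eval 2) hdiv
    rw [eval_add, eval_mul, hroot, hc, Chebyshev.C_eval_two] at this
    exact eq_neg_of_add_eq_zero_left this
  have hsplit : F.comp c * q = F.comp c * (q %ₘ c) + (F * X).comp c * (q /ₘ c) := by
    rw [mul_X_comp, mul_assoc, ← mul_add, hdiv]
  rw [hsplit, map_add, centralFunctional_comp_mul F hrem, centralFunctional_comp_mul (F * X) hquot,
    heval, mul_sub, map_sub, mul_comm F 2, ← map_ofNat (algebraMap R R[X]) 2, ← Algebra.smul_def,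
    map_smul, smul_eq_mul]
  ring

lemma centralFunctional_of_eval_two {k : ℕ} {q : R[X]} (hq : q.natDegree ≤ 2 * k + 1)
    (hroot : q.eval 2 = 0) :
    centralFunctional R k q = -(q /ₘ Chebyshev.C R (k + 1 : ℕ)).eval 2 := by
  have := centralFunctional_comp_mul_of_eval_two (F := 1) hq hroot
  rwa [one_comp, one_mul, one_mul, centralFunctional_zero_X_sub_two, mul_neg_one] at this

lemma centralFunctional_X_sub_two_pow {k r : ℕ} (hr : r ≤ k) :
    centralFunctional R k ((X - 2) ^ r) = if r = 0 then 1 else 0 := by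
  nontriviality R
  have hdeg : ((X - 2 : R[X]) ^ r).natDegree ≤ k :=
    (isMonicOfDegree_X_sub_two.pow r).natDegree_eq.trans_le (by lia)
  have := centralFunctional_comp_mul 1 hdeg
  rw [one_comp, one_mul, centralFunctional_zero_one, one_mul] at this
  simp [this, zero_pow_eq]

lemma centralFunctional_X_sub_two_pow_succ (k : ℕ) :
    centralFunctional R k ((X - 2) ^ (k + 1)) = -1 := by
  nontriviality R
  have hpow : IsMonicOfDegree ((X - 2 : R[X]) ^ (k + 1)) (k + 1) := by
    simpa using isMonicOfDegree_X_sub_two.pow (k + 1)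
  have hC := isMonicOfDegree_chebyshevC_succ (R := R) k
  have hquot : (X - 2 : R[X]) ^ (k + 1) /ₘ Chebyshev.C R (k + 1 : ℕ) = 1 :=
    (div_modByMonic_unique 1 ((X - 2) ^ (k + 1) - Chebyshev.C R (k + 1 : ℕ)) hC.monic
      ⟨by ring, by
        refine degree_lt_degree ?_
        rw [hC.natDegree_eq]
        exact hpow.natDegree_sub_lt k.succ_ne_zero hC⟩).1
  rw [centralFunctional_of_eval_two (hpow.natDegree_eq.trans_le (by lia)) (by simp), hquot,
    eval_one]

variable (R) in
/-- The Chebyshev polynomials of the third kind, rescaled so as to be monic: orthogonal for the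
central binomial moments `centralSum 0`. -/
noncomputable def chebyshevV (n : ℕ) : R[X] := Chebyshev.S R n - Chebyshev.S R (n - 1)

lemma chebyshevV_add_two (n : ℕ) :
    chebyshevV R (n + 2) = X * chebyshevV R (n + 1) - chebyshevV R n := by
  have h₁ := Chebyshev.S_add_two R n
  have h₀ := Chebyshev.S_add_one R n
  simp only [chebyshevV]
  push_cast
  rw [h₁, show (n + 2 - 1 : ℤ) = n + 1 by ring, add_sub_cancel_right, h₀]
  ring

lemma isMonicOfDegree_chebyshevV [Nontrivial R] (n : ℕ) : IsMonicOfDegree (chebyshevV R n) n := by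
  suffices IsMonicOfDegree (chebyshevV R n) (0 + n) by rwa [zero_add] at this
  refine isMonicOfDegree_of_recurrence ?_ ?_ chebyshevV_add_two n
  · simp [chebyshevV]
  · simpa [chebyshevV] using isMonicOfDegree_X_sub_one (1 : R)

lemma aeval_joukowski_chebyshevV_mul (n : ℕ) :
    aeval (joukowski R) (chebyshevV R n) * (T 1 + (1 : R) • 1) =
      T (n + 1) + (1 : R) • T (-n : ℤ) := by
  refine aeval_joukowski_mul_of_recurrence ?_ ?_ chebyshevV_add_two n
  · simp [chebyshevV]
  · have hV : chebyshevV R 1 = X - 1 := by simp [chebyshevV]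
    rw [hV, map_sub, aeval_X, map_one, sub_mul, mul_add, joukowski_mul_T, mul_smul_comm, mul_one,
      joukowski]
    simp only [one_smul, sub_self, LaurentPolynomial.T_zero]
    ring

lemma aeval_joukowski_chebyshevS_mul (n : ℕ) :
    aeval (joukowski R) (Chebyshev.S R n) * (T 2 + (-1 : R) • 1) =
      T (n + 2) + (-1 : R) • T (-n : ℤ) := by
  refine aeval_joukowski_mul_of_recurrence (P := fun n ↦ Chebyshev.S R n) ?_ ?_
    (fun n ↦ mod_cast Chebyshev.S_add_two R n) n
  · simp
  · rw [Nat.cast_one, Chebyshev.S_one, aeval_X, mul_add, joukowski_mul_T, mul_smul_comm, mul_one,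
      joukowski]
    norm_num

lemma centralFunctional_zero_chebyshevV_mul (a b : ℕ) :
    centralFunctional R 0 (chebyshevV R a * chebyshevV R b) = if a = b then 1 else 0 := by
  have := coeff_zero_aeval_joukowski_mul (by lia) (aeval_joukowski_chebyshevV_mul (R := R) a)
    (aeval_joukowski_chebyshevV_mul b)
  rwa [one_smul, ← centralFunctional_zero_apply] at this

lemma centralFunctional_zero_chebyshevS_mul (a b : ℕ) :
    centralFunctional R 0 (Chebyshev.S R a * Chebyshev.S R b * (X - 2)) =
      if a = b then -1 else 0 := by
  have := coeff_zero_aeval_joukowski_mul (by lia) (aeval_joukowski_chebyshevS_mul (R := R) a)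
    (aeval_joukowski_chebyshevS_mul b)
  rwa [neg_one_smul, ← sub_eq_add_neg, ← centralFunctional_zero_mul_X_sub_two] at this

variable (R) in
/-- A monic polynomial of degree `(k + 1) * a + r`. For `r ≤ k` these form a basis of `R[X]` in
which the bilinear form `(p, q) ↦ centralFunctional R k (p * q)` is block diagonal. -/
noncomputable def centralBasis (k a r : ℕ) : R[X] :=
  (if r = 0 then chebyshevV R a else Chebyshev.S R a).comp (Chebyshev.C R (k + 1 : ℕ)) * (X - 2) ^ r

lemma isMonicOfDegree_centralBasis [Nontrivial R] (k a r : ℕ) :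
    IsMonicOfDegree (centralBasis R k a r) ((k + 1) * a + r) := by
  have hfactor : IsMonicOfDegree (if r = 0 then chebyshevV R a else Chebyshev.S R a) a := by
    split_ifs
    exacts [isMonicOfDegree_chebyshevV a, isMonicOfDegree_chebyshevS a]
  rw [mul_comm (k + 1)]
  simpa [centralBasis] using (hfactor.comp k.succ_ne_zero (isMonicOfDegree_chebyshevC_succ k)).mul
    (isMonicOfDegree_X_sub_two.pow r)

lemma centralFunctional_centralBasis_mul {k r s : ℕ} (hr : r ≤ k) (hs : s ≤ k) (a b : ℕ) :
    centralFunctional R k (centralBasis R k a r * centralBasis R k b s) =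
      if a = b then centralFunctional R k ((X - 2) ^ (r + s)) else 0 := by
  nontriviality R
  set F := (if r = 0 then chebyshevV R a else Chebyshev.S R a) *
    (if s = 0 then chebyshevV R b else Chebyshev.S R b) with hF
  have hmul : centralBasis R k a r * centralBasis R k b s =
      F.comp (Chebyshev.C R (k + 1 : ℕ)) * (X - 2) ^ (r + s) := by
    rw [hF, mul_comp, centralBasis, centralBasis]
    ring
  have hdeg : ((X - 2 : R[X]) ^ (r + s)).natDegree = r + s := by
    simpa using (isMonicOfDegree_X_sub_two.pow (r + s)).natDegree_eq
  rw [hmul]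
  by_cases hrs : r ≠ 0 ∧ s ≠ 0
  · have hroot : ((X - 2 : R[X]) ^ (r + s)).eval 2 = 0 := by simp [hrs]
    rw [centralFunctional_comp_mul_of_eval_two (by lia) hroot, hF, if_neg hrs.1, if_neg hrs.2,
      centralFunctional_zero_chebyshevS_mul, centralFunctional_of_eval_two (by lia) hroot]
    split_ifs <;> ring
  · have hle : r + s ≤ k := by lia
    rw [centralFunctional_comp_mul F (by lia), centralFunctional_X_sub_two_pow hle]
    by_cases h : r + s = 0
    · obtain ⟨rfl, rfl⟩ := Nat.add_eq_zero_iff.1 h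
      simp [hF, centralFunctional_zero_chebyshevV_mul]
    · rw [if_neg h, ite_self, eval_pow]
      simp [zero_pow h]

end CentralFunctional

section Determinants

open Matrix

variable {R : Type*} [CommRing R]

lemma det_gram_of_monic (L : R[X] →ₗ[R] R) {n : ℕ} (p : Fin n → R[X])
    (hp : ∀ i, IsMonicOfDegree (p i) i) :
    (of fun i j ↦ L (p i * p j)).det = (of fun i j : Fin n ↦ L (X ^ (i + j : ℕ))).det := by
  set A := of fun i j : Fin n ↦ (p j).coeff i with hA
  have hsum (i : Fin n) : p i = ∑ u : Fin n, (p i).coeff u • X ^ (u : ℕ) := by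
    rw [Fin.sum_univ_eq_sum_range (fun u ↦ (p i).coeff u • (X : R[X]) ^ u) n]
    simpa only [smul_X_eq_monomial] using (p i).as_sum_range' n ((hp i).natDegree_eq.trans_lt i.2)
  have hgram : (of fun i j ↦ L (p i * p j)) =
      Aᵀ * (of fun i j : Fin n ↦ L (X ^ (i + j : ℕ))) * A := by
    ext i j
    rw [of_apply, hsum i, hsum j, Finset.sum_mul_sum, Finset.sum_comm]
    simp only [map_sum, smul_mul_smul_comm, ← pow_add, map_smul, mul_apply, Finset.sum_mul,
      transpose_apply, hA, of_apply, smul_eq_mul, mul_right_comm]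
  have hA_det : A.det = 1 :=
    det_matrixOfPolynomials p (fun i ↦ (hp i).natDegree_eq) fun i ↦ (hp i).monic
  rw [hgram, det_mul, det_mul, det_transpose, hA_det, one_mul, mul_one]

lemma det_of_antitriangular {n : ℕ} (M : Matrix (Fin n) (Fin n) R)
    (hM : ∀ i j : Fin n, (i + j + 1 : ℕ) < n → M i j = 0) :
    M.det = (-1) ^ n.choose 2 * ∏ i, M i i.rev := by
  induction n with
  | zero => simp
  | succ n ih =>
    rw [det_succ_row_zero, Finset.sum_eq_single (Fin.last n), Fin.succAbove_last, ih]
    · simp only [submatrix_apply, Fin.prod_univ_succ, Fin.rev_zero, Fin.rev_succ, Fin.val_last,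
        Nat.choose_succ_succ' n 1, Nat.choose_one_right, pow_add]
      ring
    · intro i j hij
      exact hM _ _ (by simp only [Fin.val_castSucc, Fin.val_succ]; lia)
    · intro j _ hj
      have := Fin.val_lt_last hj
      rw [hM 0 j (by simp only [Fin.val_zero]; lia), mul_zero, zero_mul]
    · simp

lemma det_of_periodic_blocks (b : ℕ → ℕ → R) {N t : ℕ} (ht : t ≤ N) (m : ℕ) :
    (of fun i j : Fin (N * m + t) ↦
      if (i / N : ℕ) = j / N then b (i % N) (j % N) else 0).det =
      (of fun i j : Fin N ↦ b i j).det ^ m * (of fun i j : Fin t ↦ b i j).det := by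
  induction m with
  | zero =>
    rw [pow_zero, one_mul, ← det_submatrix_equiv_self (finCongr (by simp : t = N * 0 + t))]
    congr 1
    ext i j
    have hi := i.2.trans_le ht
    have hj := j.2.trans_le ht
    simp [Nat.div_eq_of_lt, Nat.mod_eq_of_lt, hi, hj]
  | succ m ih =>
    have hN : N + (N * m + t) = N * (m + 1) + t := by ring
    rw [pow_succ', mul_assoc, ← ih, ← det_fromBlocks_zero₂₁ _ 0,
      ← det_submatrix_equiv_self (finSumFinEquiv.trans (finCongr hN))]
    congr 1
    ext (i | i) (j | j)
    · simp [Nat.div_eq_of_lt, Nat.mod_eq_of_lt]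
    all_goals
      have hNpos : 0 < N := Nat.pos_of_ne_zero fun h ↦ by
        have := i.2
        have := j.2
        subst h
        lia
      have hdiv (l : ℕ) : (N + l) / N = l / N + 1 := Nat.add_div_left l hNpos
    · have := Nat.div_eq_of_lt i.2
      simp [hdiv, this]
    · have := Nat.div_eq_of_lt j.2
      simp [hdiv, this]
    · simp [hdiv]

lemma hankelDet_eq_of_gap {k : ℕ} {a : ℕ → ℤ} (ha : ∀ i, 0 < i → i ≤ k → a i = 0) :
    hankelDet (k + 1) a = (-1) ^ k.choose 2 * a 0 * a (k + 1) ^ k := by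
  rw [hankelDet, det_succ_row_zero, Finset.sum_eq_single 0, det_of_antitriangular]
  · have hrev (i : Fin k) : (i + 1 + (k - (i + 1) + 1) : ℕ) = k + 1 := by lia
    simp only [of_apply, submatrix_apply, Fin.succAbove_zero, Fin.val_zero, Fin.val_succ,
      Fin.val_rev, hrev, Finset.prod_const, Finset.card_univ, Fintype.card_fin]
    ring
  · intro i j hij
    exact ha _ (by simp) (by simp only [Fin.val_succ, Fin.succAbove_zero]; lia)
  · intro j _ hj
    rw [of_apply, ha _ (by simpa [Fin.pos_iff_ne_zero] using hj) (by simp only [Fin.val_zero]; lia),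
      mul_zero, zero_mul]
  · simp

lemma hankelDet_eq_zero_of_gap {k t : ℕ} {a : ℕ → ℤ} (ha : ∀ i, 0 < i → i ≤ k → a i = 0)
    (ht : 1 < t) (htk : t ≤ k) : hankelDet t a = 0 :=
  det_eq_zero_of_row_eq_zero ⟨1, ht⟩ fun j ↦ ha _ (by simp) (by lia)

lemma hankelDet_centralSum {k t : ℕ} (ht : t ≤ k + 1) (m : ℕ) :
    hankelDet ((k + 1) * m + t) (centralSum k) =
      hankelDet (k + 1) (fun r ↦ centralFunctional ℤ k ((X - 2) ^ r)) ^ m *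
        hankelDet t fun r ↦ centralFunctional ℤ k ((X - 2) ^ r) := by
  let p (i : Fin ((k + 1) * m + t)) : ℤ[X] := centralBasis ℤ k (i / (k + 1)) (i % (k + 1))
  have hp (i) : IsMonicOfDegree (p i) i := by
    simpa only [Nat.div_add_mod] using
      isMonicOfDegree_centralBasis (R := ℤ) k (i / (k + 1)) (i % (k + 1))
  have hgram : (of fun i j ↦ centralFunctional ℤ k (p i * p j)) =
      of fun i j : Fin ((k + 1) * m + t) ↦ if (i / (k + 1) : ℕ) = j / (k + 1) then
        centralFunctional ℤ k ((X - 2) ^ (i % (k + 1) + j % (k + 1) : ℕ)) else 0 := by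
    ext i j
    exact centralFunctional_centralBasis_mul (Nat.lt_succ_iff.1 (Nat.mod_lt _ k.succ_pos))
      (Nat.lt_succ_iff.1 (Nat.mod_lt _ k.succ_pos)) _ _
  have hmoment (m : ℕ) : centralSum k m = centralFunctional ℤ k (X ^ m) := by
    rw [centralFunctional_X_pow, Int.cast_id]
  simp only [hankelDet, hmoment]
  rw [← det_gram_of_monic _ p hp, hgram,
    det_of_periodic_blocks (fun r s ↦ centralFunctional ℤ k ((X - 2) ^ (r + s))) ht]

lemma hankelDet_centralFunctional_X_sub_two_pow (k : ℕ) :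
    hankelDet (k + 1) (fun r ↦ centralFunctional ℤ k ((X - 2) ^ r)) = (-1) ^ (k + 1).choose 2 := by
  rw [hankelDet_eq_of_gap fun i hi hik ↦ by rw [centralFunctional_X_sub_two_pow hik, if_neg hi.ne'],
    centralFunctional_X_sub_two_pow_succ, centralFunctional_X_sub_two_pow k.zero_le, if_pos rfl,
    mul_one, ← pow_add, Nat.choose_succ_succ' k 1, Nat.choose_one_right, add_comm]

lemma hankelDet_centralSum_mul (k m : ℕ) :
    hankelDet ((k + 1) * m) (centralSum k) = (-1) ^ (m * (k + 1).choose 2) := by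
  have := hankelDet_centralSum (Nat.zero_le (k + 1)) m
  rwa [add_zero, hankelDet_centralFunctional_X_sub_two_pow, ← pow_mul', hankelDet.eq_def 0,
    det_isEmpty, mul_one] at this

lemma hankelDet_centralSum_mul_add_one (k m : ℕ) :
    hankelDet ((k + 1) * m + 1) (centralSum k) = (-1) ^ (m * (k + 1).choose 2) := by
  rw [hankelDet_centralSum (Nat.le_add_left 1 k), hankelDet_centralFunctional_X_sub_two_pow,
    ← pow_mul', hankelDet, det_fin_one, of_apply, Fin.val_zero, add_zero,
    centralFunctional_X_sub_two_pow k.zero_le, if_pos rfl, mul_one]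

lemma hankelDet_centralSum_eq_zero {n k : ℕ} (h₀ : ¬n ≡ 0 [MOD k + 1]) (h₁ : ¬n ≡ 1 [MOD k + 1]) :
    hankelDet n (centralSum k) = 0 := by
  have hlt := Nat.mod_lt n k.succ_pos
  have hk : k ≠ 0 := by
    rintro rfl
    exact h₀ Nat.modEq_one
  have hgap : 1 < n % (k + 1) := by
    rw [Nat.ModEq, Nat.zero_mod] at h₀
    rw [Nat.ModEq, Nat.mod_eq_of_lt (a := 1) (by lia)] at h₁
    lia
  rw [← Nat.div_add_mod n (k + 1), hankelDet_centralSum hlt.le,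
    hankelDet_eq_zero_of_gap (k := k) _ hgap (by lia), mul_zero]
  exact fun i hi hik ↦ by rw [centralFunctional_X_sub_two_pow hik, if_neg hi.ne']

lemma centralSum_zero (m : ℕ) : centralSum 0 m = m.choose ((m + 1) / 2) := by
  simp only [centralSum, binomInt, zero_add, Finset.sum_range_one]
  rw [if_pos (by lia)]
  congr 2

lemma hankelDet_centralSum_zero (n : ℕ) : hankelDet n (centralSum 0) = 1 := by
  simpa using hankelDet_centralSum_mul 0 n

end Determinants

theorem corollary13 :
    (∀ n k : ℕ, 1 ≤ n →
      (∀ n₁ : ℕ, n = (k + 1) * n₁ →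
        hankelDet n (centralSum k) = (-1) ^ (n₁ * (k + 1).choose 2)) ∧
      (∀ n₁ : ℕ, n = (k + 1) * n₁ + 1 →
        hankelDet n (centralSum k) = (-1) ^ (n₁ * (k + 1).choose 2)) ∧
      (¬ n ≡ 0 [MOD k + 1] → ¬ n ≡ 1 [MOD k + 1] →
        hankelDet n (centralSum k) = 0)) ∧
    (∀ n : ℕ, 1 ≤ n →
      hankelDet n (fun m => (m.choose ((m + 1) / 2) : ℤ)) = 1 ∧
      hankelDet n (fun m => (m.choose (m / 2) : ℤ)) = 1) := by
  refine ⟨fun n k _ ↦ ⟨?_, ?_, hankelDet_centralSum_eq_zero⟩, fun n _ ↦ ?_⟩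
  · rintro m rfl
    exact hankelDet_centralSum_mul k m
  · rintro m rfl
    exact hankelDet_centralSum_mul_add_one k m
  · have hceil : (fun m : ℕ ↦ (m.choose ((m + 1) / 2) : ℤ)) = centralSum 0 :=
      funext fun m ↦ (centralSum_zero m).symm
    have hfloor : (fun m : ℕ ↦ (m.choose (m / 2) : ℤ)) = centralSum 0 := by
      rw [← hceil]
      funext m
      rw [Nat.choose_symm_of_eq_add (show m = m / 2 + (m + 1) / 2 by lia)]
    rw [hceil, hfloor]
    exact ⟨hankelDet_centralSum_zero n, hankelDet_centralSum_zero n⟩
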